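/- Let $\Delta=\{\mathbf{e},\mathbf{n},\mathbf{w},\mathbf{s}\}=\{e_1,e_2,-e_1,-e_2\}$ be the set of unit vectors of $\mathbb{Z}^2$. An environment is a family $\omega=\{\omega_x\}_{x\in\mathbb{Z}^2}$ of stochastic matrices indexed by $\Delta$. The persistent random walk in $\omega$ with initial condition $\xi=(x_0,d_0)\in\mathbb{Z}^2\times\Delta$ is the Markov chain $(X_n,D_n)_{n\ge 0}$ on $\mathbb{Z}^2\times\Delta$, with law $P_\xi^\omega$, which starts at $\xi$ and jumps from $(x,d)$ to $(x+d',d')$ with probability $\omega_x(d,d')$ for each $d'\in\Delta$. It is called recurrent if for every initial condition $\xi\in\mathbb{Z}^2\times\Delta$, $$P_\xi^\omega\{(X_n,D_n)=\xi=(X_0,D_0)\text{ for some } n>0\}=1 .$$ For $d\in\Delta$ write $\mathbf{f}(d)=d$ (Forward), $\mathbf{b}(d)=-d$ (Backward), $\mathbf{l}(d)=d^\perp$ (Left) and $\mathbf{r}(d)=-d^\perp$ (Right), where $d^\perp$ is $d$ rotated counterclockwise by a right angle. A site $x=(x^1,x^2)$ is called even or odd according to the parity of $x^1+x^2$. Let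 $\{\zeta_x\}_{x\in\mathbb{Z}^2}$ be numbers in $[0,1]$ with $\zeta_x<1$ for all but finitely many $x$. Define the environment $\omega$ as follows: if $x$ is even and $d=\mathbf{n}$ (arrival from the South), or $x$ is odd and $d=\mathbf{s}$ (arrival from the North), then $$\omega_x(d,\mathbf{f}(d))=\zeta_x,\qquad \omega_x(d,\mathbf{l}(d))=\omega_x(d,\mathbf{r}(d))=\frac{1-\zeta_x}{2},\qquad \omega_x(d,\mathbf{b}(d))=0;$$ for all other pairs $(x,d)$, $$\omega_x(d,\mathbf{f}(d))=0,\qquad \omega_x(d,\mathbf{l}(d))=\omega_x(d,\mathbf{r}(d))=\frac12,\qquad \omega_x(d,\mathbf{b}(d))=0.$$ If $\zeta_x>0$ for at least one even site $x$ and $\zeta_y>0$ for at least one odd site $y$, then the persistent random walk in $\omega$ is recurrent. (No balance condition on the local drift $\sum_{d'}\omega_x(d,d')\,d'$ is assumed.) -/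

import Mathlib

open MeasureTheory ProbabilityTheory
open scoped ENNReal

namespace PRW

/-- The four absolute directions of `ℤ²`: East, North, West, South. -/
inductive Dir where
  | e
  | n
  | w
  | s
  deriving DecidableEq

namespace Dir

instance : Fintype Dir := ⟨{e, n, w, s}, fun d => by cases d <;> simp⟩

/-- The lattice vector of a direction: `e₁, e₂, -e₁, -e₂`. -/
def vec : Dir → ℤ × ℤ
  | e => (1, 0)
  | n => (0, 1)
  | w => (-1, 0)
  | s => (0, -1)

/-- The direction Left of `d`, i.e. `d` rotated by a right angle counterclockwise. -/
def left : Dir → Dir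
  | e => n
  | n => w
  | w => s
  | s => e

/-- The direction Right of `d`. -/
def right : Dir → Dir
  | e => s
  | n => e
  | w => n
  | s => w

/-- The direction Forward of `d`. -/
def forward (d : Dir) : Dir := d

/-- The direction Backward of `d`. -/
def backward : Dir → Dir
  | e => w
  | n => s
  | w => e
  | s => n

instance : MeasurableSpace Dir := ⊤

instance : DiscreteMeasurableSpace Dir := ⟨fun _ => trivial⟩

end Dir

/-- A state `(x, d)` of a persistent walk: current position and direction of the last jump. -/
abbrev State : Type := (ℤ × ℤ) × Dir

/-- An environment: a stochastic matrix indexed by directions at every site. -/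
abbrev Env : Type := ℤ × ℤ → Matrix.rowStochastic ℝ Dir

/-- The transition law of the walk from `(x, d)`: the walk moves to `(x + d', d')` with
probability `ω_x(d, d')`. -/
noncomputable def stepMeasure (ω : Env) (z : State) : Measure State :=
  ∑ d' : Dir, ENNReal.ofReal ((ω z.1 : Matrix Dir Dir ℝ) z.2 d') •
    Measure.dirac (z.1 + d'.vec, d')

/-- The one-step transition kernel of the walk. -/
noncomputable def stepKernel (ω : Env) : Kernel State State :=
  Kernel.ofFunOfCountable (stepMeasure ω)

instance (ω : Env) : IsMarkovKernel (stepKernel ω) := by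
  refine ⟨fun z => ⟨?_⟩⟩
  change stepMeasure ω z Set.univ = 1
  have h := Matrix.mem_rowStochastic_iff_sum.1 (ω z.1).2
  simp only [stepMeasure, Measure.finsetSum_apply, Measure.smul_apply, measure_univ,
    smul_eq_mul, mul_one]
  rw [← ENNReal.ofReal_sum_of_nonneg (fun d' _ => h.1 z.2 d'), h.2 z.2, ENNReal.ofReal_one]

/-- The transition kernel at time `k`, as a kernel from the history up to time `k`, of which it
uses only the last state. -/
noncomputable def historyKernel (ω : Env) (k : ℕ) :
    Kernel (∀ _ : Finset.Iic k, State) State :=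
  (stepKernel ω).comap (fun h => h ⟨k, Finset.mem_Iic.2 le_rfl⟩) (measurable_pi_apply _)

instance (ω : Env) (k : ℕ) : IsMarkovKernel (historyKernel ω k) := by
  unfold historyKernel; infer_instance

/-- The law `P_ξ^ω`, on the space of trajectories, of the Markov chain `(X_k, D_k)` started
at `ξ`. -/
noncomputable def law (ω : Env) (ξ : State) : Measure (ℕ → State) :=
  Kernel.traj (X := fun _ => State) (historyKernel ω) 0 (fun _ => ξ)

/-- The walk in the environment `ω` is recurrent: from every initial condition `ξ`, position and
direction return simultaneously to their initial values almost surely. -/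
def Recurrent (ω : Env) : Prop :=
  ∀ ξ : State, law ω ξ {Z | ∃ k > 0, Z k = ξ ∧ ξ = Z 0} = 1

/-- The sites with even coordinate sum. -/
def evenSites : Set (ℤ × ℤ) := {x | Even (x.1 + x.2)}

/-- The sites with odd coordinate sum. -/
def oddSites : Set (ℤ × ℤ) := evenSitesᶜ

/-- The symmetric Left-Right turning rule with Forward probability `p`: from direction `d`
Forward has probability `p`, Left and Right have probability `(1 - p) / 2` each, and Backward
has probability `0`. -/
noncomputable def turn (p : ℝ) (d d' : Dir) : ℝ :=
  if d' = d.forward then p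
  else if d' = d.left ∨ d' = d.right then (1 - p) / 2
  else 0

open Classical in
/-- The Forward probability at site `x` for incoming direction `d`: it is `ζ x` when an even site
is reached heading North, or an odd site heading South, and `0` otherwise. -/
noncomputable def forwardProb (ζ : ℤ × ℤ → unitInterval) (x : ℤ × ℤ) (d : Dir) : unitInterval :=
  if (x ∈ evenSites ∧ d = Dir.n) ∨ (x ∈ oddSites ∧ d = Dir.s) then ζ x else 0

/-- The Left-Right environment with inhomogeneous Forward probabilities `ζ`. -/
noncomputable def forwardEnv (ζ : ℤ × ℤ → unitInterval) : Env := fun x =>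
  ⟨Matrix.of fun d d' => turn (forwardProb ζ x d) d d', by
    refine Matrix.mem_rowStochastic_iff_sum.2 ⟨fun d d' => ?_, fun d => ?_⟩
    · have h0 := (forwardProb ζ x d).2.1
      have h1 := (forwardProb ζ x d).2.2
      simp only [Matrix.of_apply, turn]
      split_ifs <;> linarith
    · have hu : (Finset.univ : Finset Dir) = {Dir.e, Dir.n, Dir.w, Dir.s} := rfl
      simp only [Matrix.of_apply, hu]
      cases d <;> simp [turn, Dir.forward, Dir.left, Dir.right] <;> ring⟩

end PRW

open Filter

/-!
Identify every odd site with the even site above it. Observed at its arrivals along horizontal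
edges, the walk then performs a simple random walk on the resulting cells, because passing forward
through a site along a vertical edge does not change the cells to the left and to the right. Hence
the potential `log (|u| ^ 2 - 1)`, superharmonic for the simple random walk off a finite set, lifts
to a Lyapunov function of the persistent walk.

The probability of never visiting a given state is a bounded subharmonic function. For an
irreducible chain with a Lyapunov function `V`, a bounded subharmonic function is constant:
subtracting `ε V` moves its maximum into a finite set, where it stays as `ε` tends to `0`. A
constant positive escape probability would mean that the state cannot be entered at all, against
irreducibility.

For irreducibility, take an absorbing set of states. From a horizontal arrival at an even site the
walk can go north and then turn, as it cannot go forward at the odd site it arrives at. The reverse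
moves, south and then a turn, are possible unless `ζ = 1` at the odd site in between. As this
happens only finitely often, all even sites are reached, and likewise all odd sites from an odd one.
A site where `ζ > 0` allows the walk to switch between the two.
-/

namespace PRW

section Avoid

variable {E : Type*} {A : Set E}

/-- The trajectories that avoid `A` at the times `1, …, n`. -/
def avoid (A : Set E) (n : ℕ) : Set (ℕ → E) := {Z | ∀ k ∈ Finset.Ioc 0 n, Z k ∉ A}

lemma antitone_avoid : Antitone (avoid A) :=
  fun _ _ hmn _ hZ k hk => hZ k (Finset.Ioc_subset_Ioc_right hmn hk)

lemma avoid_succ (n : ℕ) : avoid A (n + 1) = avoid A n ∩ {Z | Z (n + 1) ∈ Aᶜ} := by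
  ext Z
  simp [avoid, ← Finset.insert_Ioc_right_eq_Ioc_add_one, and_comm]

lemma iInter_avoid : ⋂ n, avoid A n = {Z | ∀ n > 0, Z n ∉ A} := by
  ext Z
  simp only [avoid, Set.mem_iInter, Set.mem_ofPred_eq, Finset.mem_Ioc]
  exact ⟨fun h n hn => h n n ⟨hn, le_rfl⟩, fun h _ k hk => h k hk.1⟩

variable [MeasurableSpace E]

lemma exists_avoid_eq_preimage (hA : MeasurableSet A) (n : ℕ) :
    ∃ s : Set (∀ _ : Finset.Iic n, E), MeasurableSet s ∧
      avoid A n = Preorder.frestrictLe n ⁻¹' s := by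
  refine ⟨⋂ i : Finset.Iic n, ⋂ _ : 0 < i.1, {y | y i ∈ Aᶜ}, ?_, ?_⟩
  · exact .iInter fun i => .iInter fun _ => measurable_pi_apply i hA.compl
  · ext Z
    simp only [avoid, Finset.mem_Ioc, Set.mem_ofPred_eq, Set.preimage_iInter, Set.mem_iInter,
      Set.mem_preimage, Subtype.forall, Finset.mem_Iic]
    exact ⟨fun h k hkn hk => h k ⟨hk, hkn⟩, fun h k hk => h k hk.2 hk.1⟩

lemma measurableSet_avoid (hA : MeasurableSet A) (n : ℕ) : MeasurableSet (avoid A n) := by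
  obtain ⟨s, hs, h⟩ := exists_avoid_eq_preimage hA n
  exact h ▸ hs.preimage (Preorder.measurable_frestrictLe n)

end Avoid

section MarkovChain

variable {E : Type*} [MeasurableSpace E] (κ : Kernel E E)

/-- The kernels of the Markov chain with transition kernel `κ` in the form required by the
Ionescu-Tulcea theorem: the next state is drawn from `κ` at the last state of the history. -/
noncomputable def lastStateKernel (n : ℕ) : Kernel (∀ _ : Finset.Iic n, E) E :=
  κ.comap (fun h => h ⟨n, Finset.mem_Iic.2 le_rfl⟩) (measurable_pi_apply _)

/-- The taboo operator of `A`: averaging over one step of the chain, on the event that this step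
does not lead into `A`. -/
noncomputable def tabooOp (A : Set E) (f : E → ℝ≥0∞) (z : E) : ℝ≥0∞ :=
  ∫⁻ w in Aᶜ, f w ∂κ z

variable [IsMarkovKernel κ]

instance (n : ℕ) : IsMarkovKernel (lastStateKernel κ n) := by
  unfold lastStateKernel; infer_instance

/-- The law, on the space of trajectories, of the Markov chain with transition kernel `κ` started at
`z`. -/
noncomputable def chainLaw (z : E) : Measure (ℕ → E) :=
  Kernel.traj (X := fun _ => E) (lastStateKernel κ) 0 (fun _ => z)

instance (z : E) : IsProbabilityMeasure (chainLaw κ z) := by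
  unfold chainLaw; infer_instance

lemma chainLaw_ae_zero_eq [MeasurableSingletonClass E] (z : E) : ∀ᵐ Z ∂chainLaw κ z, Z 0 = z := by
  have hmap : (chainLaw κ z).map (Preorder.frestrictLe 0) = Measure.dirac (fun _ => z) := by
    rw [chainLaw, Kernel.traj_map_frestrictLe_apply, Kernel.partialTraj_self, Kernel.id_apply]
  have hdirac : ∀ᵐ y ∂(chainLaw κ z).map (Preorder.frestrictLe 0),
      y ⟨0, Finset.mem_Iic.2 le_rfl⟩ = z := by
    rw [hmap]
    exact (ae_dirac_iff (measurableSet_eq.preimage (measurable_pi_apply _))).2 rfl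
  exact ae_of_ae_map (Preorder.measurable_frestrictLe 0).aemeasurable hdirac

lemma setLIntegral_chainLaw_succ (z : E) (n : ℕ) {s : Set (∀ _ : Finset.Iic n, E)}
    (hs : MeasurableSet s) {t : Set E} (ht : MeasurableSet t) {f : E → ℝ≥0∞} (hf : Measurable f) :
    ∫⁻ Z in Preorder.frestrictLe n ⁻¹' s ∩ {Z | Z (n + 1) ∈ t}, f (Z (n + 1)) ∂chainLaw κ z =
      ∫⁻ Z in Preorder.frestrictLe n ⁻¹' s, ∫⁻ w in t, f w ∂κ (Z n) ∂chainLaw κ z := by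
  have hκf : Measurable fun w => ∫⁻ w' in t, f w' ∂κ w := hf.setLIntegral_kernel ht
  calc ∫⁻ Z in Preorder.frestrictLe n ⁻¹' s ∩ {Z | Z (n + 1) ∈ t}, f (Z (n + 1)) ∂chainLaw κ z
    _ = ∫⁻ p in s ×ˢ t, f p.2
          ∂(chainLaw κ z).map fun Z => (Preorder.frestrictLe n Z, Z (n + 1)) := by
        rw [setLIntegral_map (hs.prod ht) (by fun_prop) (by fun_prop)]
        rfl
    _ = ∫⁻ p in s ×ˢ t, f p.2
          ∂((chainLaw κ z).map (Preorder.frestrictLe n) ⊗ₘ lastStateKernel κ n) := by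
        rw [chainLaw, ← Kernel.partialTraj_compProd_eq_map_traj (Nat.zero_le n),
          Kernel.traj_map_frestrictLe_apply]
    _ = ∫⁻ y in s, ∫⁻ w in t, f w ∂lastStateKernel κ n y
          ∂(chainLaw κ z).map (Preorder.frestrictLe n) :=
        Measure.setLIntegral_compProd (by fun_prop) hs ht
    _ = ∫⁻ Z in Preorder.frestrictLe n ⁻¹' s, ∫⁻ w in t, f w ∂κ (Z n) ∂chainLaw κ z :=
        setLIntegral_map hs (hκf.comp (measurable_pi_apply _)) (by fun_prop)

variable {A : Set E}

lemma measurable_tabooOp_iterate (hA : MeasurableSet A) {f : E → ℝ≥0∞} (hf : Measurable f)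
    (n : ℕ) : Measurable ((tabooOp κ A)^[n] f) := by
  induction n with
  | zero => exact hf
  | succ n ih =>
    rw [Function.iterate_succ_apply']
    exact ih.setLIntegral_kernel hA.compl

lemma setLIntegral_avoid [MeasurableSingletonClass E] (hA : MeasurableSet A) {f : E → ℝ≥0∞}
    (hf : Measurable f) (n : ℕ) (z : E) :
    ∫⁻ Z in avoid A n, f (Z n) ∂chainLaw κ z = (tabooOp κ A)^[n] f z := by
  induction n generalizing f with
  | zero =>
    have havoid : avoid A 0 = Set.univ := by simp [avoid]
    rw [havoid, Measure.restrict_univ, Function.iterate_zero_apply,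
      lintegral_congr_ae ((chainLaw_ae_zero_eq κ z).mono fun Z hZ => congrArg f hZ),
      lintegral_const, measure_univ, mul_one]
  | succ n ih =>
    obtain ⟨s, hs, h⟩ := exists_avoid_eq_preimage hA n
    rw [avoid_succ, h, setLIntegral_chainLaw_succ κ z n hs hA.compl hf, ← h,
      Function.iterate_succ_apply]
    exact ih (hf.setLIntegral_kernel hA.compl)

lemma chainLaw_avoid [MeasurableSingletonClass E] (hA : MeasurableSet A) (n : ℕ) (z : E) :
    chainLaw κ z (avoid A n) = (tabooOp κ A)^[n] 1 z := by
  rw [← setLIntegral_avoid κ hA measurable_one n z]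
  simp

/-- The probability that the chain started at `z` never visits `A` after time `0`. -/
noncomputable def escapeProb (A : Set E) (z : E) : ℝ≥0∞ :=
  chainLaw κ z {Z | ∀ n > 0, Z n ∉ A}

lemma escapeProb_le_one (A : Set E) (z : E) : escapeProb κ A z ≤ 1 := prob_le_one

lemma escapeProb_eq_iInf [MeasurableSingletonClass E] (hA : MeasurableSet A) (z : E) :
    escapeProb κ A z = ⨅ n, (tabooOp κ A)^[n] 1 z := by
  rw [escapeProb, ← iInter_avoid, antitone_avoid.measure_iInter
    (fun n => (measurableSet_avoid hA n).nullMeasurableSet) ⟨0, measure_ne_top _ _⟩]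
  simp only [chainLaw_avoid κ hA]

lemma antitone_tabooOp_iterate_one [MeasurableSingletonClass E] (hA : MeasurableSet A) :
    Antitone fun n => (tabooOp κ A)^[n] 1 := fun m n hmn z => by
  simp only [← chainLaw_avoid κ hA]
  exact measure_mono (antitone_avoid hmn)

lemma tabooOp_escapeProb [MeasurableSingletonClass E] (hA : MeasurableSet A) :
    tabooOp κ A (escapeProb κ A) = escapeProb κ A := by
  have hmeas n := measurable_tabooOp_iterate κ hA measurable_one n
  have hanti := antitone_tabooOp_iterate_one κ hA
  funext z
  calc tabooOp κ A (escapeProb κ A) z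
    _ = ⨅ n, (tabooOp κ A)^[n + 1] 1 z := by
        simp only [Function.iterate_succ_apply']
        rw [tabooOp, funext (escapeProb_eq_iInf κ hA)]
        refine lintegral_iInf hmeas hanti (ne_top_of_le_ne_top (measure_ne_top (κ z) Aᶜ) ?_)
        simp
    _ = ⨅ n, (tabooOp κ A)^[n] 1 z :=
        (show Antitone fun n => (tabooOp κ A)^[n] 1 z from fun _ _ h => hanti h z).iInf_nat_add 1
    _ = escapeProb κ A z := (escapeProb_eq_iInf κ hA z).symm

end MarkovChain

section Irreducible

variable {E : Type*} [MeasurableSpace E]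

/-- The set `S` is absorbing for `κ`: almost surely, the chain does not leave it. -/
def IsAbsorbing (κ : Kernel E E) (S : Set E) : Prop := ∀ z ∈ S, ∀ᵐ w ∂κ z, w ∈ S

variable [DiscreteMeasurableSpace E] {κ : Kernel E E}

lemma pow_succ_apply_eq_zero_iff (n : ℕ) (z : E) (A : Set E) :
    (κ ^ (n + 1)) z A = 0 ↔ ∀ᵐ w ∂κ z, (κ ^ n) w A = 0 := by
  rw [add_comm, Kernel.pow_add_apply_eq_lintegral κ 1 n z .of_discrete, pow_one,
    lintegral_eq_zero_iff .of_discrete]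
  rfl

lemma IsAbsorbing.pow_apply_compl {S : Set E} (hS : IsAbsorbing κ S) (n : ℕ) {z : E}
    (hz : z ∈ S) : (κ ^ n) z Sᶜ = 0 := by
  induction n generalizing z with
  | zero =>
    change Kernel.id z Sᶜ = 0
    simp [Kernel.id_apply, hz]
  | succ n ih => exact (pow_succ_apply_eq_zero_iff n z _).2 ((hS z hz).mono fun w => ih)

theorem isIrreducible_count_iff : Kernel.IsIrreducible Measure.count κ ↔
    ∀ S : Set E, S.Nonempty → IsAbsorbing κ S → S = Set.univ := by
  constructor
  · rintro ⟨hirr⟩ S ⟨z, hz⟩ hS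
    by_contra hne
    obtain ⟨n, hn⟩ := hirr (A := Sᶜ) .of_discrete
      (pos_iff_ne_zero.2 (Measure.count_ne_zero (Set.nonempty_compl.2 hne))) z
    exact hn.ne' (hS.pow_apply_compl n hz)
  · refine fun h => ⟨fun A _ hA z => ?_⟩
    by_contra! hz
    let S : Set E := {w | ∀ n, (κ ^ n) w A = 0}
    have hS : IsAbsorbing κ S := fun w hw => ae_all_iff.2 fun n =>
      (pow_succ_apply_eq_zero_iff n w A).1 (hw (n + 1))
    have hSuniv : S = Set.univ := h S ⟨z, fun n => nonpos_iff_eq_zero.1 (hz n)⟩ hS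
    obtain ⟨a, ha⟩ : A.Nonempty := nonempty_of_measure_ne_zero hA.ne'
    have hzero : Kernel.id a A = 0 := (hSuniv ▸ Set.mem_univ a : a ∈ S) 0
    simp [Kernel.id_apply, ha] at hzero

end Irreducible

section Liouville

variable {E : Type*} [MeasurableSpace E]

/-- A Lyapunov function of `κ`: it has finite sublevel sets and does not increase on average in one
step of the chain, except from finitely many states. -/
structure IsLyapunov (κ : Kernel E E) (V : E → ℝ) : Prop where
  tendsto : Tendsto V cofinite atTop
  integrable : ∀ z, Integrable V (κ z)
  eventually_integral_le : ∀ᶠ z in cofinite, ∫ w, V w ∂κ z ≤ V z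

lemma ae_eq_of_le_of_le_integral {μ : Measure E} [IsProbabilityMeasure μ] {f : E → ℝ} {M : ℝ}
    (hf : Integrable f μ) (hle : ∀ w, f w ≤ M) (hM : M ≤ ∫ w, f w ∂μ) : ∀ᵐ w ∂μ, f w = M := by
  refine (integral_eq_iff_of_ae_le hf (integrable_const M) (.of_forall hle)).1 ?_
  refine le_antisymm (integral_mono hf (integrable_const M) hle) ?_
  simpa using hM

variable [DiscreteMeasurableSpace E] {κ : Kernel E E} [IsMarkovKernel κ]

theorem exists_mem_forall_le (hκ : Kernel.IsIrreducible Measure.count κ) {F : Set E}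
    (hF : F.Nonempty) {u : E → ℝ} (hint : ∀ z, Integrable u (κ z))
    (hsub : ∀ z ∉ F, u z ≤ ∫ w, u w ∂κ z) {z₁ : E} (hz₁ : ∀ w, u w ≤ u z₁) :
    ∃ y ∈ F, ∀ w, u w ≤ u y := by
  by_contra! hcon
  have hdisj : ∀ z, u z = u z₁ → z ∉ F := fun z hz hzF => by
    obtain ⟨w, hw⟩ := hcon z hzF
    exact (hz₁ w).not_gt (hz ▸ hw)
  let S : Set E := {z | u z = u z₁}
  have hS : IsAbsorbing κ S := fun z hz =>
    ae_eq_of_le_of_le_integral (hint z) hz₁ (hz.symm.trans_le (hsub z (hdisj z hz)))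
  have huniv : S = Set.univ := isIrreducible_count_iff.1 hκ S ⟨z₁, rfl⟩ hS
  obtain ⟨y, hy⟩ := hF
  exact hdisj y (huniv ▸ Set.mem_univ y : y ∈ S) hy

lemma exists_mem_forall_le_of_forall_pos {α : Type*} {F : Set α} (hfin : F.Finite)
    (hF : F.Nonempty) {f g : α → ℝ} (h : ∀ ε > 0, ∃ y ∈ F, ∀ w, f w ≤ f y + ε * g w) :
    ∃ y ∈ F, ∀ w, f w ≤ f y := by
  obtain ⟨y₀, hy₀, hmax⟩ := Set.exists_max_image F f hfin hF
  refine ⟨y₀, hy₀, fun w => ?_⟩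
  have hlim : Tendsto (fun ε : ℝ => f y₀ + ε * g w) (nhdsWithin 0 (Set.Ioi 0)) (nhds (f y₀)) := by
    refine (Continuous.tendsto' (by fun_prop) 0 _ ?_).mono_left nhdsWithin_le_nhds
    simp
  refine ge_of_tendsto hlim (eventually_mem_nhdsWithin.mono fun ε hε => ?_)
  obtain ⟨y, hy, hle⟩ := h ε hε
  exact (hle w).trans (add_le_add_left (hmax y hy) _)

lemma exists_mem_forall_le_add_mul (hκ : Kernel.IsIrreducible Measure.count κ) {F : Set E}
    (hF : F.Nonempty) {V : E → ℝ} (hV : Tendsto V cofinite atTop)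
    (hVint : ∀ z, Integrable V (κ z)) (hVF : ∀ y ∉ F, ∫ w, V w ∂κ y ≤ V y) {m : E}
    (hm : ∀ y, V m ≤ V y) {f : E → ℝ} (hbdd : BddAbove (Set.range f))
    (hfint : ∀ z, Integrable f (κ z)) (hfsub : ∀ z, f z ≤ ∫ w, f w ∂κ z) {ε : ℝ} (hε : 0 < ε) :
    ∃ y ∈ F, ∀ w, f w ≤ f y + ε * (V w - V m) := by
  have : Nonempty E := ⟨m⟩
  obtain ⟨b, hb⟩ := hbdd
  let u : E → ℝ := fun y => f y - ε * V y
  have huint : ∀ y, Integrable u (κ y) := fun y => (hfint y).sub ((hVint y).const_mul ε)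
  have husub : ∀ y ∉ F, u y ≤ ∫ w, u w ∂κ y := fun y hy => by
    rw [integral_sub (hfint y) ((hVint y).const_mul ε), integral_const_mul]
    exact sub_le_sub (hfsub y) (by gcongr; exact hVF y hy)
  have hubot : Tendsto u cofinite atBot := by
    refine tendsto_atBot_mono (fun y => sub_le_sub_right (hb ⟨y, rfl⟩) (ε * V y)) ?_
    simpa only [sub_eq_add_neg] using tendsto_const_nhds.add_atBot
      (tendsto_neg_atBot_iff.2 (hV.const_mul_atTop hε))
  obtain ⟨z₁, hz₁⟩ := hubot.exists_forall_ge
  obtain ⟨y, hyF, hy⟩ := exists_mem_forall_le hκ hF huint husub hz₁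
  refine ⟨y, hyF, fun w => ?_⟩
  have hw : f w - ε * V w ≤ f y - ε * V y := hy w
  have hmy : ε * V m ≤ ε * V y := by gcongr; exact hm y
  linarith

theorem IsLyapunov.le_of_le_integral {V : E → ℝ} (hV : IsLyapunov κ V)
    (hκ : Kernel.IsIrreducible Measure.count κ) {f : E → ℝ} (hbdd : BddAbove (Set.range f))
    (hfint : ∀ z, Integrable f (κ z)) (hfsub : ∀ z, f z ≤ ∫ w, f w ∂κ z) (z w : E) :
    f w ≤ f z := by
  have : Nonempty E := ⟨z⟩
  let F : Set E := insert z {y | ¬ ∫ w, V w ∂κ y ≤ V y}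
  have hFne : F.Nonempty := ⟨z, Set.mem_insert z _⟩
  have hVF : ∀ y ∉ F, ∫ w, V w ∂κ y ≤ V y := fun y hy =>
    not_not.1 fun h => hy (Set.mem_insert_of_mem z h)
  obtain ⟨m, hm⟩ := hV.tendsto.exists_forall_le
  have hperturb (ε : ℝ) (hε : 0 < ε) : ∃ y ∈ F, ∀ w, f w ≤ f y + ε * (V w - V m) :=
    exists_mem_forall_le_add_mul hκ hFne hV.tendsto hV.integrable hVF hm hbdd hfint hfsub hε
  have hFfin : F.Finite := Set.Finite.insert z hV.eventually_integral_le
  obtain ⟨z₁, -, hz₁⟩ := exists_mem_forall_le_of_forall_pos hFfin hFne hperturb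
  obtain ⟨y, rfl, hy⟩ := exists_mem_forall_le hκ (Set.singleton_nonempty z) hfint
    (fun y _ => hfsub y) hz₁
  exact hy w

lemma toReal_escapeProb_le_integral (A : Set E) (z : E) :
    (escapeProb κ A z).toReal ≤ ∫ w, (escapeProb κ A w).toReal ∂κ z := by
  have hle : escapeProb κ A z ≤ ∫⁻ w, escapeProb κ A w ∂κ z := by
    conv_lhs => rw [← tabooOp_escapeProb κ .of_discrete]
    exact setLIntegral_le_lintegral _ _
  rw [integral_toReal Measurable.of_discrete.aemeasurable
    (.of_forall fun w => (escapeProb_le_one κ A w).trans_lt ENNReal.one_lt_top)]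
  refine ENNReal.toReal_mono (ne_top_of_le_ne_top ENNReal.one_ne_top ?_) hle
  simpa using lintegral_mono (μ := κ z) (escapeProb_le_one κ A)

theorem IsLyapunov.escapeProb_eq {V : E → ℝ} (hV : IsLyapunov κ V)
    (hκ : Kernel.IsIrreducible Measure.count κ) (A : Set E) (z w : E) :
    escapeProb κ A w = escapeProb κ A z := by
  have hne (y) : escapeProb κ A y ≠ ⊤ := measure_ne_top _ _
  have hle_one (y) : (escapeProb κ A y).toReal ≤ 1 :=
    ENNReal.toReal_le_of_le_ofReal zero_le_one (by simpa using escapeProb_le_one κ A y)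
  have hint (y) : Integrable (fun y => (escapeProb κ A y).toReal) (κ y) :=
    .of_bound (C := 1) Measurable.of_discrete.aestronglyMeasurable
      (.of_forall fun y => by simpa using hle_one y)
  have hle := hV.le_of_le_integral hκ
    ⟨1, Set.forall_mem_range.2 hle_one⟩ hint (toReal_escapeProb_le_integral A)
  exact (ENNReal.toReal_eq_toReal_iff' (hne w) (hne z)).1 (le_antisymm (hle z w) (hle w z))

theorem IsLyapunov.escapeProb_eq_zero {V : E → ℝ} (hV : IsLyapunov κ V)
    (hκ : Kernel.IsIrreducible Measure.count κ) {A : Set E} (hA : A.Nonempty) (z : E) :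
    escapeProb κ A z = 0 := by
  have hconst := hV.escapeProb_eq hκ A z
  by_contra hz
  have hcompl (w) : κ w Aᶜ = 1 := by
    have htaboo := congrFun (tabooOp_escapeProb κ (A := A) .of_discrete) w
    simp only [tabooOp, hconst, lintegral_const, Measure.restrict_apply_univ] at htaboo
    exact (ENNReal.mul_eq_left hz (measure_ne_top _ _)).1 htaboo
  have habs : IsAbsorbing κ Aᶜ := fun w _ => (mem_ae_iff_prob_eq_one .of_discrete).2 (hcompl w)
  have hnonempty : Aᶜ.Nonempty := nonempty_of_measure_ne_zero (μ := κ z) (by simp [hcompl])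
  have huniv := isIrreducible_count_iff.1 hκ Aᶜ hnonempty habs
  exact hA.ne_empty (Set.compl_univ_iff.1 huniv)

end Liouville

section Walk

variable (ω : Env) (z : State)

lemma integrable_stepKernel (f : State → ℝ) : Integrable f (stepKernel ω z) := by
  change Integrable f (stepMeasure ω z)
  exact integrable_finsetSum_measure.2 fun d' _ =>
    (integrable_dirac (by finiteness)).smul_measure ENNReal.ofReal_ne_top

lemma integral_stepKernel (f : State → ℝ) : ∫ w, f w ∂stepKernel ω z =
    ∑ d', (ω z.1 : Matrix Dir Dir ℝ) z.2 d' * f (z.1 + d'.vec, d') := by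
  change ∫ w, f w ∂stepMeasure ω z = _
  have hnonneg := (Matrix.mem_rowStochastic_iff_sum.1 (ω z.1).2).1 z.2
  rw [stepMeasure, integral_finsetSum_measure fun d' _ =>
    (integrable_dirac (by finiteness)).smul_measure ENNReal.ofReal_ne_top]
  simp only [integral_smul_measure, integral_dirac, ENNReal.toReal_ofReal (hnonneg _),
    smul_eq_mul]

variable {ω z}

lemma IsAbsorbing.add_vec_mem {S : Set State} (hS : IsAbsorbing (stepKernel ω) S) (hz : z ∈ S)
    {d' : Dir} (hd' : 0 < (ω z.1 : Matrix Dir Dir ℝ) z.2 d') : (z.1 + d'.vec, d') ∈ S := by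
  have hsum : ∀ᵐ w ∂stepMeasure ω z, w ∈ S := hS z hz
  rw [stepMeasure, ae_finsetSum_measure_iff] at hsum
  have hdirac := hsum d' (Finset.mem_univ d')
  rw [Measure.ae_ennreal_smul_measure_iff (ENNReal.ofReal_pos.2 hd').ne'] at hdirac
  simpa using hdirac

theorem IsLyapunov.recurrent {V : State → ℝ} (hV : IsLyapunov (stepKernel ω) V)
    (hω : Kernel.IsIrreducible Measure.count (stepKernel ω)) : Recurrent ω := fun ξ => by
  change chainLaw (stepKernel ω) ξ _ = 1
  have hreturn := measure_eq_zero_iff_ae_notMem.1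
    (hV.escapeProb_eq_zero hω (Set.singleton_nonempty ξ) ξ)
  have hmem : ∀ᵐ Z ∂chainLaw (stepKernel ω) ξ, ∃ k > 0, Z k = ξ ∧ ξ = Z 0 := by
    filter_upwards [hreturn, chainLaw_ae_zero_eq (stepKernel ω) ξ] with Z hZ hZ0
    simpa [hZ0] using hZ
  exact (measure_congr (eventuallyEq_univ.2 hmem)).trans measure_univ

end Walk

section ForwardEnv

variable {ζ : ℤ × ℤ → unitInterval} {x : ℤ × ℤ} {d : Dir}

lemma integral_forwardEnv (f : State → ℝ) : ∫ w, f w ∂stepKernel (forwardEnv ζ) (x, d) =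
    forwardProb ζ x d * f (x + d.vec, d) + (1 - forwardProb ζ x d) / 2 *
      (f (x + d.left.vec, d.left) + f (x + d.right.vec, d.right)) := by
  have huniv : (Finset.univ : Finset Dir) = {.e, .n, .w, .s} := rfl
  rw [integral_stepKernel, huniv]
  cases d <;>
    simp [forwardEnv, turn, Dir.forward, Dir.left, Dir.right] <;> ring

end ForwardEnv

/-- The walk arriving at the site `x` in direction `d` is allowed to proceed forward; it then does
so with probability `ζ x`. -/
def MayGoForward (x : ℤ × ℤ) (d : Dir) : Prop :=
  (x ∈ evenSites ∧ d = .n) ∨ (x ∈ oddSites ∧ d = .s)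

section Parity

variable {ζ : ℤ × ℤ → unitInterval} {x : ℤ × ℤ} {d : Dir}

lemma forwardProb_eq (h : MayGoForward x d) : forwardProb ζ x d = ζ x := if_pos h

lemma forwardProb_eq_zero (h : ¬ MayGoForward x d) : forwardProb ζ x d = 0 := if_neg h

lemma MayGoForward.eq_n_or_eq_s (h : MayGoForward x d) : d = .n ∨ d = .s :=
  h.imp And.right And.right

lemma vec_backward (d : Dir) : d.backward.vec = -d.vec := by
  cases d <;> rfl

lemma backward_backward (d : Dir) : d.backward.backward = d := by
  cases d <;> rfl

lemma add_vec_backward_add_vec (x : ℤ × ℤ) (d : Dir) : x + d.backward.vec + d.vec = x := by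
  rw [vec_backward, neg_add_cancel_right]

lemma add_vec_mem_evenSites_iff : x + d.vec ∈ evenSites ↔ x ∈ oddSites := by
  change Even _ ↔ ¬ Even _
  simp only [Int.even_iff]
  cases d <;> simp only [Dir.vec, Prod.fst_add, Prod.snd_add] <;> omega

lemma add_vec_mem_oddSites_iff : x + d.vec ∈ oddSites ↔ x ∈ evenSites :=
  (not_congr add_vec_mem_evenSites_iff).trans not_not

lemma MayGoForward.add_vec_backward (h : MayGoForward x d) (d' : Dir) :
    MayGoForward (x + d'.vec) d.backward := by
  obtain ⟨hx, rfl⟩ | ⟨hx, rfl⟩ := h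
  · exact .inr ⟨add_vec_mem_oddSites_iff.2 hx, rfl⟩
  · exact .inl ⟨add_vec_mem_evenSites_iff.2 hx, rfl⟩

lemma MayGoForward.not_add_vec (h : MayGoForward x d) (d' : Dir) :
    ¬ MayGoForward (x + d'.vec) d := by
  obtain ⟨hx, rfl⟩ | ⟨hx, rfl⟩ := h
  · simpa [MayGoForward, add_vec_mem_evenSites_iff, oddSites] using hx
  · rintro (⟨-, h⟩ | ⟨h, -⟩)
    · cases h
    · exact hx (add_vec_mem_oddSites_iff.1 h)

end Parity

section Cell

/-- The coordinates of the cell containing the site `x`. A cell is a domino consisting of an odd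
site, where both divisions are exact, and the even site above it, where both round down. Passing
forward through a site does not change the cells to its left and right. -/
def cell (x : ℤ × ℤ) : ℤ × ℤ := ((x.2 + x.1 + 1) / 2, (x.2 - x.1 + 1) / 2)

/-- The function on the states of the walk induced by a function `h` on the cells: on arrivals along
a horizontal edge it is `h` at the current cell, and on arrivals along a vertical edge the mean of
`h` over the cells to the left and to the right. -/
noncomputable def lift (h : ℤ × ℤ → ℝ) : State → ℝ
  | (x, .e) | (x, .w) => h (cell x)
  | (x, .n) | (x, .s) => (h (cell (x + Dir.e.vec)) + h (cell (x + Dir.w.vec))) / 2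

/-- The mean of `h` over the four neighbors of `u`, the transition operator of the simple random
walk on `ℤ²`. -/
noncomputable def neighborMean (h : ℤ × ℤ → ℝ) (u : ℤ × ℤ) : ℝ :=
  (h (u + (1, 0)) + h (u + (0, 1)) + h (u - (1, 0)) + h (u - (0, 1))) / 4

section

variable (x : ℤ × ℤ)

lemma cell_add_n_add_e : cell (x + Dir.n.vec + Dir.e.vec) = cell x + (1, 0) := by
  ext <;> simp only [cell, Dir.vec, Prod.fst_add, Prod.snd_add] <;> omega

lemma cell_add_n_add_w : cell (x + Dir.n.vec + Dir.w.vec) = cell x + (0, 1) := by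
  ext <;> simp only [cell, Dir.vec, Prod.fst_add, Prod.snd_add] <;> omega

lemma cell_add_s_add_e : cell (x + Dir.s.vec + Dir.e.vec) = cell x - (0, 1) := by
  ext <;> simp only [cell, Dir.vec, Prod.fst_add, Prod.snd_add, Prod.fst_sub, Prod.snd_sub] <;>
    omega

lemma cell_add_s_add_w : cell (x + Dir.s.vec + Dir.w.vec) = cell x - (1, 0) := by
  ext <;> simp only [cell, Dir.vec, Prod.fst_add, Prod.snd_add, Prod.fst_sub, Prod.snd_sub] <;>
    omega

end

variable {x : ℤ × ℤ} {d : Dir} {h : ℤ × ℤ → ℝ} {ζ : ℤ × ℤ → unitInterval}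

lemma cell_add_n (hx : x ∈ oddSites) : cell (x + Dir.n.vec) = cell x := by
  obtain ⟨k, hk⟩ := Int.not_even_iff_odd.1 hx
  ext <;> simp only [cell, Dir.vec, Prod.fst_add, Prod.snd_add] <;> omega

lemma lift_add_vec (hx : MayGoForward x d) : lift h (x + d.vec, d) = lift h (x, d) := by
  obtain ⟨hx, rfl⟩ | ⟨hx, rfl⟩ := hx
  · simp only [lift, add_right_comm x Dir.n.vec]
    rw [cell_add_n (add_vec_mem_oddSites_iff.2 hx), cell_add_n (add_vec_mem_oddSites_iff.2 hx)]
  · have hcell (d' : Dir) : cell (x + Dir.s.vec + d'.vec) = cell (x + d'.vec) := by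
      have hodd : x + Dir.s.vec + d'.vec ∈ oddSites :=
        add_vec_mem_oddSites_iff.2 (add_vec_mem_evenSites_iff.2 hx)
      have hback : x + Dir.s.vec + Dir.n.vec = x := add_vec_backward_add_vec x .n
      rw [← cell_add_n hodd, add_right_comm, hback]
    simp only [lift, hcell]

lemma integral_lift_of_horizontal (hd : d = .e ∨ d = .w) :
    ∫ w, lift h w ∂stepKernel (forwardEnv ζ) (x, d) = neighborMean h (cell x) := by
  have hcalc : ((h (cell x + (1, 0)) + h (cell x + (0, 1))) / 2 +
      (h (cell x - (0, 1)) + h (cell x - (1, 0))) / 2) / 2 = neighborMean h (cell x) := by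
    rw [neighborMean]; ring
  have hp : forwardProb ζ x d = 0 := by
    obtain rfl | rfl := hd <;> simp [forwardProb]
  rw [integral_forwardEnv, hp, ← hcalc]
  obtain rfl | rfl := hd <;>
  · simp only [Dir.left, Dir.right, lift, cell_add_n_add_e, cell_add_n_add_w, cell_add_s_add_e,
      cell_add_s_add_w, Set.Icc.coe_zero]
    ring

lemma integral_lift_of_vertical (hd : d = .n ∨ d = .s) :
    ∫ w, lift h w ∂stepKernel (forwardEnv ζ) (x, d) = lift h (x, d) := by
  have hforward : (forwardProb ζ x d : ℝ) * lift h (x + d.vec, d) =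
      forwardProb ζ x d * lift h (x, d) := by
    by_cases hx : MayGoForward x d
    · rw [lift_add_vec hx]
    · simp [forwardProb_eq_zero hx]
  have hturn : lift h (x + d.left.vec, d.left) + lift h (x + d.right.vec, d.right) =
      2 * lift h (x, d) := by
    obtain rfl | rfl := hd <;> simp only [lift, Dir.left, Dir.right] <;> ring
  rw [integral_forwardEnv, hforward, hturn]
  ring

lemma integral_lift_le (hh : neighborMean h (cell x) ≤ h (cell x)) :
    ∫ w, lift h w ∂stepKernel (forwardEnv ζ) (x, d) ≤ lift h (x, d) := by
  cases d
  · exact (integral_lift_of_horizontal (.inl rfl)).trans_le hh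
  · exact (integral_lift_of_vertical (.inl rfl)).le
  · exact (integral_lift_of_horizontal (.inr rfl)).trans_le hh
  · exact (integral_lift_of_vertical (.inr rfl)).le

lemma tendsto_cell : Tendsto cell cofinite cofinite := by
  refine .cofinite_of_finite_preimage_singleton fun u => ?_
  refine (Set.finite_Icc (u.1 - u.2 - 1, u.1 + u.2 - 1) (u.1 - u.2 + 1, u.1 + u.2)).subset
    fun x hx => ?_
  obtain rfl : cell x = u := hx
  simp only [cell, Set.mem_Icc, Prod.le_def]
  omega

lemma tendsto_cell_fst_add (v : ℤ × ℤ) :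
    Tendsto (fun z : State => cell (z.1 + v)) cofinite cofinite := by
  refine (tendsto_cell.comp (add_left_injective v).tendsto_cofinite).comp ?_
  refine .cofinite_of_finite_preimage_singleton fun x => ?_
  exact ((Set.finite_singleton x).prod Set.finite_univ).subset fun z hz => ⟨hz, trivial⟩

lemma tendsto_lift (hh : Tendsto h cofinite atTop) : Tendsto (lift h) cofinite atTop := by
  have hlarge (b : ℝ) (v : ℤ × ℤ) : ∀ᶠ z : State in cofinite, b ≤ h (cell (z.1 + v)) :=
    (hh.comp (tendsto_cell_fst_add v)).eventually_ge_atTop b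
  refine tendsto_atTop.2 fun b => ?_
  filter_upwards [hlarge b 0, hlarge b Dir.e.vec, hlarge b Dir.w.vec] with ⟨x, d⟩ h0 he hw
  rw [add_zero] at h0
  cases d <;> simp only [lift] <;> linarith

theorem isLyapunov_lift (hh : Tendsto h cofinite atTop)
    (hmean : ∀ᶠ u in cofinite, neighborMean h u ≤ h u) :
    IsLyapunov (stepKernel (forwardEnv ζ)) (lift h) where
  tendsto := tendsto_lift hh
  integrable z := integrable_stepKernel _ z _
  eventually_integral_le := by
    filter_upwards [(tendsto_cell_fst_add 0).eventually hmean] with ⟨x, d⟩ hx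
    rw [add_zero] at hx
    exact integral_lift_le hx

end Cell

section LogPotential

/-- A potential on the plane that is unbounded and, away from the origin, superharmonic for the
simple random walk. Without the shift by `-1`, superharmonicity fails on the diagonals. At the
origin and its four neighbors the logarithm is taken of a nonpositive number. -/
noncomputable def logPotential (u : ℤ × ℤ) : ℝ := Real.log ((u.1 : ℝ) ^ 2 + (u.2 : ℝ) ^ 2 - 1)

lemma tendsto_sq_add_sq :
    Tendsto (fun u : ℤ × ℤ => (u.1 : ℝ) ^ 2 + (u.2 : ℝ) ^ 2) cofinite atTop := by
  have hnorm : Tendsto (fun u : ℤ × ℤ => ‖u‖ ^ 2) cofinite atTop := by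
    rw [← cocompact_eq_cofinite]
    exact (tendsto_pow_atTop two_ne_zero).comp tendsto_norm_cocompact_atTop
  refine tendsto_atTop_mono (fun u => ?_) hnorm
  rcases max_cases ‖u.1‖ ‖u.2‖ with ⟨h, -⟩ | ⟨h, -⟩ <;>
    rw [Prod.norm_def, h, Int.norm_eq_abs, sq_abs] <;>
    nlinarith [sq_nonneg (u.1 : ℝ), sq_nonneg (u.2 : ℝ)]

lemma tendsto_logPotential : Tendsto logPotential cofinite atTop :=
  Real.tendsto_log_atTop.comp (tendsto_atTop_add_const_right _ _ tendsto_sq_add_sq)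

lemma mul_add_mul_sub_le_sub_one_pow_four {a b s : ℝ} (hs : a ^ 2 + b ^ 2 = s) (h2 : 2 ≤ s) :
    (s + 2 * a) * (s + 2 * b) * (s - 2 * a) * (s - 2 * b) ≤ (s - 1) ^ 4 := by
  have hab : 4 * (a ^ 2 * b ^ 2) ≤ s ^ 2 := by nlinarith [sq_nonneg (a ^ 2 - b ^ 2)]
  calc (s + 2 * a) * (s + 2 * b) * (s - 2 * a) * (s - 2 * b)
    _ = s ^ 4 - 4 * s ^ 2 * (a ^ 2 + b ^ 2) + 4 * (4 * (a ^ 2 * b ^ 2)) := by ring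
    _ ≤ s ^ 4 - 4 * s ^ 2 * s + 4 * s ^ 2 := by rw [hs]; gcongr
    _ ≤ (s - 1) ^ 4 := by nlinarith

lemma log_add_log_add_log_add_log_le {a b s : ℝ} (hs : a ^ 2 + b ^ 2 = s) (h5 : 5 ≤ s) :
    Real.log (s + 2 * a) + Real.log (s + 2 * b) + Real.log (s - 2 * a) + Real.log (s - 2 * b) ≤
      4 * Real.log (s - 1) := by
  obtain ⟨ha₁, ha₂⟩ : -s < 2 * a ∧ 2 * a < s :=
    abs_lt.1 (abs_lt_of_sq_lt_sq (by nlinarith) (by linarith))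
  obtain ⟨hb₁, hb₂⟩ : -s < 2 * b ∧ 2 * b < s :=
    abs_lt.1 (abs_lt_of_sq_lt_sq (by nlinarith) (by linarith))
  have hpa : 0 < s + 2 * a := by linarith
  have hpb : 0 < s + 2 * b := by linarith
  have hma : 0 < s - 2 * a := by linarith
  have hmb : 0 < s - 2 * b := by linarith
  have hpos := mul_pos (mul_pos (mul_pos hpa hpb) hma) hmb
  rw [← Real.log_mul hpa.ne' hpb.ne', ← Real.log_mul (mul_pos hpa hpb).ne' hma.ne',
    ← Real.log_mul (mul_pos (mul_pos hpa hpb) hma).ne' hmb.ne']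
  calc _ ≤ Real.log ((s - 1) ^ 4) :=
        Real.log_le_log hpos (mul_add_mul_sub_le_sub_one_pow_four hs (by linarith))
    _ = 4 * Real.log (s - 1) := by rw [Real.log_pow]; norm_cast

lemma neighborMean_logPotential_le {u : ℤ × ℤ} (hu : 5 ≤ (u.1 : ℝ) ^ 2 + (u.2 : ℝ) ^ 2) :
    neighborMean logPotential u ≤ logPotential u := by
  have hlog := log_add_log_add_log_add_log_le rfl hu
  simp only [neighborMean, logPotential, Prod.fst_add, Prod.snd_add, Prod.fst_sub, Prod.snd_sub]
  push_cast
  ring_nf at hlog ⊢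
  linarith

end LogPotential

section Plane

lemma exists_forall_of_eventually_cofinite {p : ℤ × ℤ → Prop} (hp : ∀ᶠ u in cofinite, p u) :
    ∃ r b : ℤ, ∀ u : ℤ × ℤ, r < u.1 ∨ u.2 < b → p u := by
  have hfin : {u | ¬ p u}.Finite := hp
  obtain ⟨⟨r, t⟩, hrt⟩ := hfin.bddAbove
  obtain ⟨⟨l, b⟩, hlb⟩ := hfin.bddBelow
  refine ⟨r, b, fun u hu => by_contra fun hpu => ?_⟩
  obtain ⟨hru, -⟩ := Prod.mk_le_mk.1 (hrt hpu)
  obtain ⟨-, hbu⟩ := Prod.mk_le_mk.1 (hlb hpu)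
  omega

lemma eq_univ_of_add_mem_of_eventually_sub_mem {G : Set (ℤ × ℤ)} (hne : G.Nonempty)
    (hright : ∀ u ∈ G, u + (1, 0) ∈ G) (hup : ∀ u ∈ G, u + (0, 1) ∈ G)
    (hleft : ∀ᶠ u in cofinite, u ∈ G → u - (1, 0) ∈ G)
    (hdown : ∀ᶠ u in cofinite, u ∈ G → u - (0, 1) ∈ G) : G = Set.univ := by
  obtain ⟨⟨i, j⟩, hij⟩ := hne
  obtain ⟨r, b, hrb⟩ := exists_forall_of_eventually_cofinite (hleft.and hdown)
  refine Set.eq_univ_of_forall fun ⟨k, l⟩ => ?_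
  -- Go right past all exceptional points, down below all of them, left to column `k`, and up.
  obtain ⟨i', hii', hki', hri'⟩ : ∃ i', i ≤ i' ∧ k ≤ i' ∧ r < i' :=
    ⟨max (max i k) (r + 1), by omega, by omega, by omega⟩
  obtain ⟨j', hj'j, hj'l, hj'b⟩ : ∃ j', j' ≤ j ∧ j' ≤ l ∧ j' < b :=
    ⟨min (min j l) (b - 1), by omega, by omega, by omega⟩
  have hi'j : (i', j) ∈ G :=
    Int.leInduction hij (fun m _ hm => by simpa using hright _ hm) i' hii'
  have hi'j' : (i', j') ∈ G :=
    Int.leInductionDown hi'j (fun m _ hm => by simpa using (hrb _ (.inl hri')).2 hm) j' hj'j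
  have hkj' : (k, j') ∈ G :=
    Int.leInductionDown hi'j' (fun m _ hm => by simpa using (hrb _ (.inr hj'b)).1 hm) k hki'
  exact Int.leInduction hkj' (fun m _ hm => by simpa using hup _ hm) l hj'l

end Plane

section AbsorbingSets

/-- Some state in `S` consists of the site `x` and the direction of an arrival along a horizontal
edge. -/
def Horizontal (S : Set State) (x : ℤ × ℤ) : Prop := (x, Dir.e) ∈ S ∨ (x, Dir.w) ∈ S

/-- The site reached from `x` by `u.1` diagonal moves `d`-then-right and `u.2` diagonal moves
`d`-then-left. -/
def diagSite (x : ℤ × ℤ) (d : Dir) (u : ℤ × ℤ) : ℤ × ℤ :=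
  x + u.1 • (d.vec + d.right.vec) + u.2 • (d.vec + d.left.vec)

variable {ζ : ℤ × ℤ → unitInterval} {S : Set State} {x y : ℤ × ℤ} {d d' : Dir}

lemma turn_mem (hS : IsAbsorbing (stepKernel (forwardEnv ζ)) S) (h : (x, d) ∈ S)
    (hζ : forwardProb ζ x d ≠ 1) (hd' : d' = d.left ∨ d' = d.right) : (x + d'.vec, d') ∈ S := by
  refine hS.add_vec_mem h ?_
  have hne : d' ≠ d.forward := by
    obtain rfl | rfl := hd' <;> cases d <;> simp [Dir.forward, Dir.left, Dir.right]
  have hlt : (forwardProb ζ x d : ℝ) < 1 :=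
    lt_of_le_of_ne (forwardProb ζ x d).2.2 (by simpa using hζ)
  simp only [forwardEnv, turn, Matrix.of_apply, if_neg hne, if_pos hd']
  linarith

lemma forward_mem (hS : IsAbsorbing (stepKernel (forwardEnv ζ)) S) (h : (x, d) ∈ S)
    (hζ : 0 < forwardProb ζ x d) : (x + d.vec, d) ∈ S := by
  refine hS.add_vec_mem h ?_
  simpa [forwardEnv, turn, Dir.forward] using hζ

lemma Horizontal.add_vec_mem (hS : IsAbsorbing (stepKernel (forwardEnv ζ)) S) (h : Horizontal S x)
    (hd : d = .n ∨ d = .s) : (x + d.vec, d) ∈ S := by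
  obtain h | h := h <;> refine turn_mem hS h ?_ ?_
  · simp [forwardProb]
  · simpa [Dir.left, Dir.right] using hd
  · simp [forwardProb]
  · simpa [Dir.left, Dir.right, or_comm] using hd

lemma horizontal_add_vec (hS : IsAbsorbing (stepKernel (forwardEnv ζ)) S) (h : (x, d) ∈ S)
    (hd : d = .n ∨ d = .s) (hζ : forwardProb ζ x d ≠ 1) (hd' : d' = d.left ∨ d' = d.right) :
    Horizontal S (x + d'.vec) := by
  have hmem := turn_mem hS h hζ hd'
  obtain rfl | rfl : d' = .e ∨ d' = .w := by
    obtain rfl | rfl := hd <;> simpa [Dir.left, Dir.right, or_comm] using hd'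
  exacts [.inl hmem, .inr hmem]

lemma injective_diagSite (hd : d = .n ∨ d = .s) : Function.Injective (diagSite x d) := by
  intro u v h
  obtain rfl | rfl := hd <;>
  · simp only [diagSite, Dir.vec, Dir.left, Dir.right, Prod.ext_iff, Prod.fst_add, Prod.snd_add,
      Prod.smul_fst, Prod.smul_snd, smul_eq_mul] at h ⊢
    omega

lemma MayGoForward.exists_diagSite_eq (hx : MayGoForward x d) (hy : MayGoForward y d) :
    ∃ u, diagSite x d u = y := by
  have heven : (y.1 - x.1 + (y.2 - x.2)) % 2 = 0 := by
    simp only [MayGoForward, evenSites, oddSites, Set.mem_compl_iff, Set.mem_ofPred_eq,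
      Int.even_iff] at hx hy
    obtain ⟨hx, rfl⟩ | ⟨hx, rfl⟩ := hx <;>
      obtain ⟨hy, hd⟩ | ⟨hy, hd⟩ := hy <;>
      first | omega | cases hd
  obtain ⟨u, h₁, h₂⟩ : ∃ u : ℤ × ℤ, u.1 - u.2 = y.1 - x.1 ∧ u.1 + u.2 = y.2 - x.2 :=
    ⟨((y.1 - x.1 + (y.2 - x.2)) / 2, (y.2 - x.2 - (y.1 - x.1)) / 2), by omega, by omega⟩
  obtain rfl | rfl := hx.eq_n_or_eq_s
  · refine ⟨u, ?_⟩
    ext <;> simp only [diagSite, Dir.vec, Dir.left, Dir.right, Prod.fst_add, Prod.snd_add,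
      Prod.smul_fst, Prod.smul_snd, smul_eq_mul] <;> omega
  · refine ⟨-u, ?_⟩
    ext <;> simp only [diagSite, Dir.vec, Dir.left, Dir.right, Prod.fst_add, Prod.snd_add,
      Prod.smul_fst, Prod.smul_snd, smul_eq_mul, Prod.fst_neg, Prod.snd_neg] <;> omega

lemma diagSite_mem_evenSites_iff (u : ℤ × ℤ) : diagSite x d u ∈ evenSites ↔ x ∈ evenSites := by
  change Even _ ↔ Even _
  simp only [Int.even_iff]
  cases d <;> simp only [diagSite, Dir.vec, Dir.left, Dir.right, Prod.fst_add, Prod.snd_add,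
    Prod.smul_fst, Prod.smul_snd, smul_eq_mul] <;> omega

lemma mayGoForward_diagSite (h : MayGoForward x d) (u : ℤ × ℤ) :
    MayGoForward (diagSite x d u) d :=
  h.imp (And.imp_left (diagSite_mem_evenSites_iff u).2)
    (And.imp_left (not_congr (diagSite_mem_evenSites_iff u)).2)

lemma diagSite_add_right (u : ℤ × ℤ) :
    diagSite x d (u + (1, 0)) = diagSite x d u + d.vec + d.right.vec := by
  simp only [diagSite, Prod.fst_add, Prod.snd_add, add_smul, one_smul, zero_smul]
  abel

lemma diagSite_add_left (u : ℤ × ℤ) :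
    diagSite x d (u + (0, 1)) = diagSite x d u + d.vec + d.left.vec := by
  simp only [diagSite, Prod.fst_add, Prod.snd_add, add_smul, one_smul, zero_smul]
  abel

lemma right_backward (d : Dir) : d.backward.right = d.right.backward := by
  cases d <;> rfl

lemma left_backward (d : Dir) : d.backward.left = d.left.backward := by
  cases d <;> rfl

lemma diagSite_sub_right (u : ℤ × ℤ) : diagSite x d (u - (1, 0)) =
    diagSite x d u + d.backward.vec + d.backward.right.vec := by
  rw [right_backward, vec_backward, vec_backward]
  simp only [diagSite, Prod.fst_sub, Prod.snd_sub, sub_smul, one_smul, zero_smul]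
  abel

lemma diagSite_sub_left (u : ℤ × ℤ) : diagSite x d (u - (0, 1)) =
    diagSite x d u + d.backward.vec + d.backward.left.vec := by
  rw [left_backward, vec_backward, vec_backward]
  simp only [diagSite, Prod.fst_sub, Prod.snd_sub, sub_smul, one_smul, zero_smul]
  abel

lemma Horizontal.step (hS : IsAbsorbing (stepKernel (forwardEnv ζ)) S) (h : Horizontal S x)
    (hd : d = .n ∨ d = .s) (hζ : forwardProb ζ (x + d.vec) d ≠ 1)
    (hd' : d' = d.left ∨ d' = d.right) : Horizontal S (x + d.vec + d'.vec) :=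
  horizontal_add_vec hS (h.add_vec_mem hS hd) hd hζ hd'

theorem Horizontal.of_mayGoForward (h : Horizontal S x)
    (hS : IsAbsorbing (stepKernel (forwardEnv ζ)) S) (hfin : {x | ζ x = 1}.Finite)
    (hx : MayGoForward x d) (hy : MayGoForward y d) : Horizontal S y := by
  have hd := hx.eq_n_or_eq_s
  have hd' : d.backward = .n ∨ d.backward = .s := by
    obtain rfl | rfl := hd <;> simp [Dir.backward]
  have hforth (u) : forwardProb ζ (diagSite x d u + d.vec) d ≠ 1 := by
    simp [forwardProb_eq_zero ((mayGoForward_diagSite hx u).not_add_vec d)]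
  have hback : ∀ᶠ u in cofinite,
      forwardProb ζ (diagSite x d u + d.backward.vec) d.backward ≠ 1 := by
    have hinj : Function.Injective fun u => diagSite x d u + d.backward.vec :=
      (add_left_injective _).comp (injective_diagSite hd)
    filter_upwards [hinj.tendsto_cofinite.eventually hfin.eventually_cofinite_notMem] with u hu
    rwa [forwardProb_eq ((mayGoForward_diagSite hx u).add_vec_backward _)]
  let G : Set (ℤ × ℤ) := {u | Horizontal S (diagSite x d u)}
  have hmem (u) : u ∈ G ↔ Horizontal S (diagSite x d u) := Iff.rfl
  have huniv : G = Set.univ := by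
    apply eq_univ_of_add_mem_of_eventually_sub_mem
    · exact ⟨0, by simpa [hmem, diagSite] using h⟩
    · intro u hu
      rw [hmem, diagSite_add_right]
      exact Horizontal.step hS hu hd (hforth u) (.inr rfl)
    · intro u hu
      rw [hmem, diagSite_add_left]
      exact Horizontal.step hS hu hd (hforth u) (.inl rfl)
    · filter_upwards [hback] with u hζ hu
      rw [hmem, diagSite_sub_right]
      exact Horizontal.step hS hu hd' hζ (.inr rfl)
    · filter_upwards [hback] with u hζ hu
      rw [hmem, diagSite_sub_left]
      exact Horizontal.step hS hu hd' hζ (.inl rfl)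
  obtain ⟨u, rfl⟩ := hx.exists_diagSite_eq hy
  exact (hmem u).1 (huniv ▸ Set.mem_univ u)

lemma Horizontal.add_vec_add_e (h : Horizontal S (x + d.backward.vec))
    (hS : IsAbsorbing (stepKernel (forwardEnv ζ)) S) (hx : MayGoForward x d) (hζ : 0 < ζ x) :
    Horizontal S (x + d.vec + Dir.e.vec) := by
  have hd := hx.eq_n_or_eq_s
  have hxd : (x, d) ∈ S := by simpa only [add_vec_backward_add_vec] using h.add_vec_mem hS hd
  have hforward : (x + d.vec, d) ∈ S := forward_mem hS hxd (by rwa [forwardProb_eq hx])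
  refine horizontal_add_vec hS hforward hd ?_ ?_
  · simp [forwardProb_eq_zero (hx.not_add_vec d)]
  · obtain rfl | rfl := hd <;> simp [Dir.left, Dir.right]

lemma exists_horizontal (hS : IsAbsorbing (stepKernel (forwardEnv ζ)) S) (hne : S.Nonempty) :
    ∃ x, Horizontal S x := by
  obtain ⟨⟨x, d⟩, h⟩ := hne
  by_cases hd : d = .n ∨ d = .s
  · by_cases hp : forwardProb ζ x d = 1
    · have hx : MayGoForward x d := by
        by_contra hx
        simp [forwardProb_eq_zero hx] at hp
      have hforward : (x + d.vec, d) ∈ S := forward_mem hS h (by simp [hp])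
      have hp' : forwardProb ζ (x + d.vec) d ≠ 1 := by
        simp [forwardProb_eq_zero (hx.not_add_vec d)]
      exact ⟨_, horizontal_add_vec hS hforward hd hp' (.inl rfl)⟩
    · exact ⟨_, horizontal_add_vec hS h hd hp (.inl rfl)⟩
  · refine ⟨x, ?_⟩
    cases d <;> simp_all [Horizontal]

lemma exists_mayGoForward (x : ℤ × ℤ) : ∃ d, MayGoForward x d :=
  (em (x ∈ evenSites)).elim (fun hx => ⟨.n, .inl ⟨hx, rfl⟩⟩) fun hx => ⟨.s, .inr ⟨hx, rfl⟩⟩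

lemma mayGoForward_or_mayGoForward_backward (hd : d = .n ∨ d = .s) (x : ℤ × ℤ) :
    MayGoForward x d ∨ MayGoForward x d.backward := by
  obtain rfl | rfl := hd <;> simp [MayGoForward, Dir.backward, oddSites, em, em']

theorem forall_horizontal (hS : IsAbsorbing (stepKernel (forwardEnv ζ)) S) (hne : S.Nonempty)
    (hfin : {x | ζ x = 1}.Finite) (hpos : ∀ d, d = .n ∨ d = .s → ∃ x, MayGoForward x d ∧ 0 < ζ x)
    (y : ℤ × ℤ) : Horizontal S y := by
  obtain ⟨x, h⟩ := exists_horizontal hS hne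
  obtain ⟨d, hx⟩ := exists_mayGoForward x
  have hd := hx.eq_n_or_eq_s
  obtain ⟨z, hz, hζ⟩ := hpos d.backward (by obtain rfl | rfl := hd <;> simp [Dir.backward])
  have hbefore : MayGoForward (z + d.backward.backward.vec) d := by
    simpa only [backward_backward] using hz.add_vec_backward d.backward.backward
  have hafter : MayGoForward (z + d.backward.vec + Dir.e.vec) d.backward := by
    simpa only [backward_backward] using
      (hz.add_vec_backward d.backward).add_vec_backward .e
  have hswitch : Horizontal S (z + d.backward.vec + Dir.e.vec) :=
    (h.of_mayGoForward hS hfin hx hbefore).add_vec_add_e hS hz hζ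
  obtain hy | hy := mayGoForward_or_mayGoForward_backward hd y
  · exact h.of_mayGoForward hS hfin hx hy
  · exact hswitch.of_mayGoForward hS hfin hafter hy

lemma eq_univ_of_forall_horizontal (hS : IsAbsorbing (stepKernel (forwardEnv ζ)) S)
    (h : ∀ x, Horizontal S x) : S = Set.univ := by
  have hvertical (x : ℤ × ℤ) (d : Dir) (hd : d = .n ∨ d = .s) : (x, d) ∈ S := by
    simpa only [add_vec_backward_add_vec] using (h (x + d.backward.vec)).add_vec_mem hS hd
  refine Set.eq_univ_of_forall fun ⟨x, d⟩ => ?_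
  by_cases hd : d = .n ∨ d = .s
  · exact hvertical x d hd
  · obtain ⟨d', hd', hturn⟩ : ∃ d', (d' = .n ∨ d' = .s) ∧
        ¬ MayGoForward (x + d.backward.vec) d' := by
      obtain ⟨d', hx⟩ := exists_mayGoForward x
      exact ⟨d', hx.eq_n_or_eq_s, hx.not_add_vec d.backward⟩
    have hside : d = d'.left ∨ d = d'.right := by
      cases d <;> obtain rfl | rfl := hd' <;> simp_all [Dir.left, Dir.right]
    have hp : forwardProb ζ (x + d.backward.vec) d' ≠ 1 := by simp [forwardProb_eq_zero hturn]
    simpa only [add_vec_backward_add_vec] using turn_mem hS (hvertical _ d' hd') hp hside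

theorem isIrreducible_forwardEnv (hfin : {x | ζ x = 1}.Finite)
    (heven : ∃ x ∈ evenSites, 0 < ζ x) (hodd : ∃ x ∈ oddSites, 0 < ζ x) :
    Kernel.IsIrreducible Measure.count (stepKernel (forwardEnv ζ)) := by
  refine isIrreducible_count_iff.2 fun S hne hS =>
    eq_univ_of_forall_horizontal hS (forall_horizontal hS hne hfin ?_)
  rintro d (rfl | rfl)
  · exact heven.imp fun x hx => ⟨.inl ⟨hx.1, rfl⟩, hx.2⟩
  · exact hodd.imp fun x hx => ⟨.inr ⟨hx.1, rfl⟩, hx.2⟩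

end AbsorbingSets

end PRW

theorem mainTheorem4 (ζ : ℤ × ℤ → unitInterval)
    (hfin : {x : ℤ × ℤ | ζ x = 1}.Finite)
    (heven : ∃ x ∈ PRW.evenSites, 0 < ζ x)
    (hodd : ∃ y ∈ PRW.oddSites, 0 < ζ y) :
    PRW.Recurrent (PRW.forwardEnv ζ) := by
  have hV : PRW.IsLyapunov (PRW.stepKernel (PRW.forwardEnv ζ)) (PRW.lift PRW.logPotential) := by
    refine PRW.isLyapunov_lift PRW.tendsto_logPotential ?_
    filter_upwards [PRW.tendsto_sq_add_sq.eventually_ge_atTop 5] with u hu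
    exact PRW.neighborMean_logPotential_le hu
  exact hV.recurrent (PRW.isIrreducible_forwardEnv hfin heven hodd)
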